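/- Let $D\ge 1$, $\mathcal X=[\underline x_1,\overline x_1]\times\dots\times[\underline x_D,\overline x_D]\subset\mathbb R^D$ with $\underline x_i<\overline x_i$, let $\varrho\in(1,\infty)^D$ and $N=(N_1,\dots,N_D)\in\mathbb N_0^D$. Let $B([-1,1],r)=\{z\in\mathbb C: |z-1|+|z+1|<r+r^{-1}\}$ be the open Bernstein ellipse (foci $\pm1$, sum of semi-axes $r$), let $\tau_i(z)=\overline x_i+\frac{\underline x_i-\overline x_i}{2}(1-z)$ be the affine map taking $[-1,1]$ onto $[\underline x_i,\overline x_i]$, and put $B(\mathcal X,\varrho)=\prod_{i=1}^D\tau_i\big(B([-1,1],\varrho_i)\big)\subset\mathbb C^D$. For $g:[-1,1]^D\to\mathbb R$ the tensorized Chebyshev interpolation is $I_N(g)(t)=\sum_{j\in J}c_j\prod_{i=1}^D T_{j_i}(t_i)$, where $J=\{j\in\mathbb N_0^D: j_i\le N_i \text{ for all } i\}$, $T_n$ is the $n$-th Chebyshev polynomial of the first kind, and $$c_j=\Big(\prod_{i=1}^D\frac{2^{\mathbf 1_{\{0<j_i<N_i\}}}}{N_i}\Big)\sum_{k_1=0}^{N_1}{}''\cdots\sum_{k_D=0}^{N_D}{}''\,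 g\Big(\cos\frac{\pi k_1}{N_1},\dots,\cos\frac{\pi k_D}{N_D}\Big)\prod_{i=1}^D\cos\Big(j_i\pi\frac{k_i}{N_i}\Big),$$ $\sum''$ meaning that the first and the last summand are halved. If $N_i=0$, the interpolation in the $i$-th variable is the constant interpolation at the single node $1$: the factor $1/N_i$ is read as $1$, $k_i/N_i$ as $0$, and the single summand is not halved. For $f:\mathcal X\to\mathbb R$ put $I_N(f)=I_N(f\circ\tau)\circ\tau^{-1}$ with $\tau=(\tau_1,\dots,\tau_D)$. Suppose that $f:\mathcal X\to\mathbb R$ has an analytic extension, again written $f$, to $B(\mathcal X,\varrho)$ with $|f(z)|\le V<\infty$ for all $z\in B(\mathcal X,\varrho)$. Then $$\max_{x\in\mathcal X}|f(x)-I_N(f)(x)|\le\min_{\sigma\in S_D}\Bigg(\sum_{i=1}^D4V\frac{\varrho_{\sigma(i)}^{-N_{\sigma(i)}}}{\varrho_{\sigma(i)}-1}+\sum_{k=2}^D4V\frac{\varrho_{\sigma(k)}^{-N_{\sigma(k)}}}{\varrho_{\sigma(k)}-1}\cdot2^{k-1}\,\frac{(k-1)+2^{k-1}-1}{\prod_{j=1}^{k-1}\big(1-\frac1{\varrho_{\sigma(j)}}\big)}\Bigg),$$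 where $S_D$ is the symmetric group on $D$ elements. -/

import Mathlib

noncomputable section

namespace TensorChebyshev

/-- The affine transform `τ_{[a,b]}` taking `[-1,1]` to `[a,b]`, on the real line. -/
def transform (a b : ℝ) (t : ℝ) : ℝ := b + (a - b) / 2 * (1 - t)

/-- The inverse of `transform a b` (for `a < b`), taking `[a,b]` to `[-1,1]`. -/
def transformInv (a b : ℝ) (x : ℝ) : ℝ := 1 - 2 * (b - x) / (b - a)

/-- The transform `τ_{[a,b]}` on the complex plane: real parts are mapped by
`b + (a - b) / 2 * (1 - re z)` and imaginary parts by `(b - a) / 2 * im z`. -/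
def transformC (a b : ℝ) (z : ℂ) : ℂ :=
  ⟨b + (a - b) / 2 * (1 - z.re), (b - a) / 2 * z.im⟩

/-- The open Bernstein ellipse `B([-1,1], ϱ)`: the open region bounded by the ellipse with foci
`-1` and `1` whose semi-axes `(ϱ + ϱ⁻¹) / 2` and `(ϱ - ϱ⁻¹) / 2` add up to `ϱ`. -/
def bernsteinEllipse (ϱ : ℝ) : Set ℂ := {z | ‖z - 1‖ + ‖z + 1‖ < ϱ + ϱ⁻¹}

/-- The Bernstein ellipse `B([a,b], ϱ)` of an interval `[a,b]`. -/
def bernsteinEllipseOn (a b ϱ : ℝ) : Set ℂ := transformC a b '' bernsteinEllipse ϱ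

/-- The generalized Bernstein ellipse `B([a₁,b₁],ϱ₁) × … × B([a_D,b_D],ϱ_D)`. -/
def genBernsteinEllipse {D : ℕ} (a b ϱ : Fin D → ℝ) : Set (Fin D → ℂ) :=
  Set.univ.pi fun i => bernsteinEllipseOn (a i) (b i) (ϱ i)

/-- The Chebyshev node `cos (π k / N)`; for `N = 0` the only node (`k = 0`) is `cos 0 = 1`. -/
def node (N k : ℕ) : ℝ := Real.cos (Real.pi * ((k : ℝ) / (N : ℝ)))

/-- The factor `2 ^ 1_{0 < j < N} / N`; it is set to `1` for `N = 0`. -/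
def factor (N j : ℕ) : ℝ :=
  if N = 0 then 1 else (if 0 < j ∧ j < N then 2 else 1) / (N : ℝ)

/-- The weight of the `k`-th summand in a sum over `0, …, N` whose first and last summands
are halved; for `N = 0` the only summand is not halved. -/
def weight (N k : ℕ) : ℝ :=
  if N = 0 then 1 else if k = 0 ∨ k = N then 1 / 2 else 1

/-- The index set `J` of all multi-indices `j` with `j i ≤ N i` for all `i`. -/
def multiIndices {D : ℕ} (N : Fin D → ℕ) : Finset (Fin D → ℕ) :=
  Fintype.piFinset fun i => Finset.range (N i + 1)

/-- The coefficient `c_j` of the tensorized Chebyshev interpolation of `g : [-1,1]^D → ℝ`. -/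
def coeff {D : ℕ} (N : Fin D → ℕ) (g : (Fin D → ℝ) → ℝ) (j : Fin D → ℕ) : ℝ :=
  (∏ i, factor (N i) (j i)) *
    ∑ k ∈ multiIndices N, (∏ i, weight (N i) (k i)) *
      (g (fun i => node (N i) (k i)) *
        ∏ i, Real.cos ((j i : ℝ) * Real.pi * ((k i : ℝ) / (N i : ℝ))))

/-- The tensorized Chebyshev interpolation `∑_{j ∈ J} c_j T_j` of `g : [-1,1]^D → ℝ`. -/
def interpStd {D : ℕ} (N : Fin D → ℕ) (g : (Fin D → ℝ) → ℝ) (t : Fin D → ℝ) : ℝ :=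
  ∑ j ∈ multiIndices N,
    coeff N g j * ∏ i, (Polynomial.Chebyshev.T ℝ (j i : ℤ)).eval (t i)

/-- The tensorized Chebyshev interpolation on the hyperrectangle `∏ i, [a i, b i]`, transported
from `[-1,1]^D` by the affine transforms. -/
def interp {D : ℕ} (a b : Fin D → ℝ) (N : Fin D → ℕ) (f : (Fin D → ℝ) → ℝ)
    (x : Fin D → ℝ) : ℝ :=
  interpStd N (fun t => f fun i => transform (a i) (b i) (t i))
    (fun i => transformInv (a i) (b i) (x i))

/-- The error bound belonging to one order `σ` of the coordinates. The index `k : Fin D` starts at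
`0`, so that `(k : ℕ)` is the usual `k - 1`. -/
def permBound {D : ℕ} (V : ℝ) (ϱ : Fin D → ℝ) (N : Fin D → ℕ) (σ : Equiv.Perm (Fin D)) : ℝ :=
  (∑ i, 4 * V * (ϱ (σ i) ^ (-(N (σ i) : ℤ)) / (ϱ (σ i) - 1))) +
    ∑ k ∈ Finset.univ.filter (fun k : Fin D => 1 ≤ (k : ℕ)),
      4 * V * (ϱ (σ k) ^ (-(N (σ k) : ℤ)) / (ϱ (σ k) - 1)) *
        (2 ^ (k : ℕ) * ((((k : ℕ) : ℝ) + 2 ^ (k : ℕ) - 1) /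
          ∏ j ∈ Finset.univ.filter (fun j : Fin D => j < k), (1 - 1 / ϱ (σ j))))

/-- The error bound `a(ϱ, N, D)`: the minimum of `permBound` over the symmetric group. -/
def errorBound {D : ℕ} (V : ℝ) (ϱ : Fin D → ℝ) (N : Fin D → ℕ) : ℝ :=
  (Finset.univ : Finset (Equiv.Perm (Fin D))).inf' Finset.univ_nonempty (permBound V ϱ N)

end TensorChebyshev

end

/-!
In one variable, a function `F` that is analytic and bounded by `V` on the Bernstein ellipse of
parameter `ϱ` has a Chebyshev expansion `F (cos θ) = ∑ n, a n * cos (n θ)` with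
`‖a n‖ ≤ 2 V ϱ⁻ⁿ` (`exists_hasSum_cos`): this is the Fourier series of `F (cos θ)`, whose
coefficients are Laurent coefficients of `F ∘ joukowski` on an annulus and are estimated by shifting
the contour. Interpolation at the Chebyshev nodes reproduces `T_m` for `m ≤ N` by discrete
orthogonality, and by aliasing it sends every other `T_n` to some `T_m` with `m ≤ N`. Summing the
expansion term by term shows that the interpolation error is at most `4 V ϱ⁻ᴺ / (ϱ - 1)`
(`norm_sub_interpOne_le`) and that the interpolant is at most `2 V / (1 - 1 / ϱ)`, uniformly in `N`
(`norm_interpOne_le`).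

In several variables the error is the telescoping sum
`1 - I₁ ⋯ I_D = ∑ k, I₁ ⋯ I_{k-1} (1 - I_k)`. The one-dimensional error `(1 - I_k) F`, with the
`k`-th and all later variables fixed at real points, is again analytic in the remaining variables
separately and bounded on their ellipses, so the two one-dimensional bounds can be composed by
induction on the dimension (`norm_sub_interpTensor_le`). This gives
`∑ k, ε k * ∏ j < k, 2 / (1 - 1 / ϱ j)` with `ε k = 4 V ϱ_k ^ (-N_k) / (ϱ_k - 1)`, which is at most
the stated bound. Interpolation operators in different variables commute, so the variables may be
taken in any order. The maximum is attained because the error is continuous on a compact box.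
-/

noncomputable section

open Complex Polynomial.Chebyshev

namespace TensorChebyshev

/-! ### Discrete orthogonality of cosines -/

lemma sum_weight_mul {N : ℕ} (hN : N ≠ 0) (u : ℕ → ℝ) :
    ∑ k ∈ Finset.range (N + 1), weight N k * u k =
      ∑ k ∈ Finset.range N, (u k + u (k + 1)) / 2 := by
  obtain ⟨M, rfl⟩ := Nat.exists_eq_succ_of_ne_zero hN
  rw [Finset.sum_range_succ, Finset.sum_range_succ', ← Finset.sum_div, Finset.sum_add_distrib,
    Finset.sum_range_succ (fun k => u (k + 1)), Finset.sum_range_succ' u]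
  have : ∑ k ∈ Finset.range M, weight M.succ (k + 1) * u (k + 1) =
      ∑ k ∈ Finset.range M, u (k + 1) := by
    refine Finset.sum_congr rfl fun k hk => ?_
    have := Finset.mem_range.1 hk
    simp [weight, this.ne]
  rw [this]
  simp [weight]
  ring

/-- The trapezoidal sum of `cos (p θ)` over the grid `θ = π k / N`: aliasing kills every frequency
that is not a multiple of `2 N`. -/
lemma sum_weight_mul_cos {N : ℕ} (hN : N ≠ 0) (p : ℤ) :
    ∑ k ∈ Finset.range (N + 1), weight N k * Real.cos (p * (Real.pi * ((k : ℝ) / N))) =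
      if (2 * N : ℤ) ∣ p then (N : ℝ) else 0 := by
  have hN' : (N : ℝ) ≠ 0 := by exact_mod_cast hN
  have hpi := Real.pi_ne_zero
  rw [sum_weight_mul hN]
  split_ifs with h
  · obtain ⟨q, rfl⟩ := h
    have h1 (k : ℕ) : Real.cos (((2 * N * q : ℤ) : ℝ) * (Real.pi * ((k : ℝ) / N))) = 1 := by
      rw [Real.cos_eq_one_iff]
      refine ⟨q * k, ?_⟩
      push_cast
      field_simp
    simp only [h1]
    norm_num
  · set β : ℝ := p * Real.pi / (2 * N) with hβ
    have hsin : Real.sin β ≠ 0 := by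
      rw [Ne, Real.sin_eq_zero_iff]
      rintro ⟨q, hq⟩
      apply h
      refine ⟨q, ?_⟩
      rw [hβ, eq_div_iff (by positivity)] at hq
      have : (q : ℝ) * (2 * N) = p := mul_right_cancel₀ hpi (by linear_combination hq)
      have h2 : ((2 * N * q : ℤ) : ℝ) = (p : ℤ) := by push_cast; linear_combination this
      exact_mod_cast h2.symm
    -- After multiplication by `2 sin β` the sum telescopes.
    have key (k : ℕ) : Real.sin β * ((Real.cos (p * (Real.pi * ((k : ℝ) / N))) +
        Real.cos (p * (Real.pi * (((k + 1 : ℕ) : ℝ) / N)))) / 2) =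
        Real.cos β * Real.sin (2 * (k + 1 : ℕ) * β) / 2 - Real.cos β * Real.sin (2 * k * β) / 2 := by
      have e1 : (p : ℝ) * (Real.pi * ((k : ℝ) / N)) = 2 * k * β := by rw [hβ]; field_simp
      have e2 : (p : ℝ) * (Real.pi * (((k + 1 : ℕ) : ℝ) / N)) = 2 * k * β + 2 * β := by
        rw [hβ]; push_cast; field_simp
      have e3 : 2 * ((k + 1 : ℕ) : ℝ) * β = 2 * k * β + 2 * β := by push_cast; ring
      rw [e1, e2, e3, Real.sin_add, Real.cos_add, Real.cos_two_mul, Real.sin_two_mul]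
      linear_combination
        (-Real.cos β * Real.sin (2 * k * β)) * Real.sin_sq_add_cos_sq β
    apply (mul_eq_zero.1 _).resolve_left hsin
    rw [Finset.mul_sum, Finset.sum_congr rfl fun k _ => key k,
      Finset.sum_range_sub (fun k : ℕ => Real.cos β * Real.sin (2 * k * β) / 2)]
    have : 2 * (N : ℝ) * β = p * Real.pi := by rw [hβ]; field_simp
    simp [this, Real.sin_int_mul_pi]

lemma factor_mul_sum_cos_mul_cos {N : ℕ} (hN : N ≠ 0) {j m : ℕ} (hj : j ≤ N) (hm : m ≤ N) :
    factor N j * ∑ k ∈ Finset.range (N + 1), weight N k *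
      (Real.cos (j * (Real.pi * ((k : ℝ) / N))) * Real.cos (m * (Real.pi * ((k : ℝ) / N)))) =
      if j = m then 1 else 0 := by
  have hN' : (N : ℝ) ≠ 0 := by exact_mod_cast hN
  have h (k : ℕ) : weight N k *
      (Real.cos (j * (Real.pi * ((k : ℝ) / N))) * Real.cos (m * (Real.pi * ((k : ℝ) / N)))) =
      (weight N k * Real.cos (((j - m : ℤ) : ℝ) * (Real.pi * ((k : ℝ) / N))) +
        weight N k * Real.cos (((j + m : ℤ) : ℝ) * (Real.pi * ((k : ℝ) / N)))) / 2 := by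
    push_cast
    rw [sub_mul, add_mul, Real.cos_sub, Real.cos_add]
    ring
  simp only [h]
  rw [← Finset.sum_div, Finset.sum_add_distrib, sum_weight_mul_cos hN, sum_weight_mul_cos hN]
  have small {p : ℤ} (h1 : 0 < p) (h2 : p < 2 * N) : ¬ (2 * N : ℤ) ∣ p :=
    fun hd => absurd (Int.le_of_dvd h1 hd) (by omega)
  split_ifs with h1 h2 h3 h3 h2 h3 h3
  · subst h3
    obtain rfl | hj0 := Nat.eq_zero_or_pos j
    · simp [factor, hN]
    obtain rfl | hjN := hj.eq_or_lt
    · simp [factor, hN]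
    exact absurd h2 (small (by omega) (by omega))
  · have : (2 * N : ℤ) ∣ (m - j : ℤ) := by rw [← neg_sub]; exact (dvd_neg).2 h1
    rcases lt_or_gt_of_ne h3 with h | h
    · exact absurd this (small (by omega) (by omega))
    · exact absurd h1 (small (by omega) (by omega))
  · subst h3
    have hj0 : j ≠ 0 := by rintro rfl; simp at h2
    have hjN : j ≠ N := by rintro rfl; exact h2 ⟨1, by ring⟩
    have : 0 < j ∧ j < N := by omega
    simp [factor, hN, this]
  · have : (2 * N : ℤ) ∣ (m - j : ℤ) := by rw [← neg_sub]; exact (dvd_neg).2 h1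
    rcases lt_or_gt_of_ne h3 with h | h
    · exact absurd this (small (by omega) (by omega))
    · exact absurd h1 (small (by omega) (by omega))
  · subst h3; simp at h1
  · exact absurd h2 (small (by omega) (by omega))
  · subst h3; simp at h1
  · simp

/-! ### The Chebyshev interpolation operator in one variable -/

/-- The `k`-th cardinal function of Chebyshev interpolation of degree `N`: the coefficient of the
nodal value at `node N k` in the value of the interpolant at `t`. -/
def cardinal (N k : ℕ) (t : ℝ) : ℝ :=
  ∑ j ∈ Finset.range (N + 1), factor N j * (weight N k *
    Real.cos (j * (Real.pi * ((k : ℝ) / N)))) * (T ℝ (j : ℤ)).eval t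

/-- Chebyshev interpolation reproduces `T_m` for `m ≤ N`. -/
lemma sum_cardinal_mul_cos {N m : ℕ} (hm : m ≤ N) (t : ℝ) :
    ∑ k ∈ Finset.range (N + 1), cardinal N k t * Real.cos (m * (Real.pi * ((k : ℝ) / N))) =
      (T ℝ (m : ℤ)).eval t := by
  obtain rfl | hN := eq_or_ne N 0
  · obtain rfl : m = 0 := by omega
    simp [cardinal, factor, weight]
  simp only [cardinal, Finset.sum_mul]
  rw [Finset.sum_comm]
  have h (j : ℕ) (hj : j ∈ Finset.range (N + 1)) :
      ∑ k ∈ Finset.range (N + 1), factor N j * (weight N k *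
        Real.cos (j * (Real.pi * ((k : ℝ) / N)))) * (T ℝ (j : ℤ)).eval t *
          Real.cos (m * (Real.pi * ((k : ℝ) / N))) =
      if j = m then (T ℝ (j : ℤ)).eval t else 0 := by
    have := factor_mul_sum_cos_mul_cos hN (j := j) (m := m)
      (Nat.lt_succ_iff.1 (Finset.mem_range.1 hj)) hm
    rw [← one_mul ((T ℝ (j : ℤ)).eval t), ← zero_mul ((T ℝ (j : ℤ)).eval t), ← ite_mul, ← this,
      Finset.mul_sum, Finset.sum_mul]
    exact Finset.sum_congr rfl fun k _ => by ring
  rw [Finset.sum_congr rfl h, Finset.sum_ite_eq' , if_pos (Finset.mem_range.2 (by omega))]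

/-- Aliasing: on the grid `π k / N` every frequency coincides with one that is at most `N`. -/
lemma exists_le_cos_eq (N n : ℕ) : ∃ m ≤ N, ∀ k : ℕ,
    Real.cos (n * (Real.pi * ((k : ℝ) / N))) = Real.cos (m * (Real.pi * ((k : ℝ) / N))) := by
  obtain rfl | hN := eq_or_ne N 0
  · exact ⟨0, le_rfl, by simp⟩
  have hN' : (N : ℝ) ≠ 0 := by exact_mod_cast hN
  have hlt := Nat.mod_lt n (show 0 < 2 * N by omega)
  have hn : (n : ℝ) = 2 * N * (n / (2 * N) : ℕ) + (n % (2 * N) : ℕ) := by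
    exact_mod_cast (Nat.div_add_mod n (2 * N)).symm
  by_cases h : n % (2 * N) ≤ N
  · refine ⟨n % (2 * N), h, fun k => ?_⟩
    rw [eq_comm, ← Real.cos_add_nat_mul_two_pi _ (n / (2 * N) * k)]
    congr 1
    conv_rhs => rw [hn]
    push_cast
    field_simp
    ring
  · refine ⟨2 * N - n % (2 * N), by omega, fun k => ?_⟩
    rw [← Real.cos_neg, ← Real.cos_add_nat_mul_two_pi _ ((n / (2 * N) + 1) * k)]
    congr 1
    nth_rw 1 [hn]
    push_cast [hlt.le]
    field_simp
    ring

lemma abs_sum_cardinal_mul_cos_le (N n : ℕ) {t : ℝ} (ht : |t| ≤ 1) :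
    |∑ k ∈ Finset.range (N + 1), cardinal N k t * Real.cos (n * (Real.pi * ((k : ℝ) / N)))| ≤ 1 := by
  obtain ⟨m, hm, h⟩ := exists_le_cos_eq N n
  simp only [h]
  rw [sum_cardinal_mul_cos hm]
  exact abs_eval_T_real_le_one _ ht

/-! ### Chebyshev expansions of functions analytic on a Bernstein ellipse -/

/-- The Joukowski map `w ↦ (w + w⁻¹) / 2`. -/
def joukowski (w : ℂ) : ℂ := (w + w⁻¹) / 2

lemma joukowski_exp (θ : ℝ) : joukowski (exp (θ * I)) = (Real.cos θ : ℂ) := by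
  rw [joukowski, ← Complex.exp_neg, ofReal_cos, Complex.cos, neg_mul]

lemma isOpen_bernsteinEllipse (ϱ : ℝ) : IsOpen (bernsteinEllipse ϱ) :=
  isOpen_lt (by fun_prop) continuous_const

lemma norm_sub_one_add_norm_add_one_joukowski {w : ℂ} (hw : w ≠ 0) :
    ‖joukowski w - 1‖ + ‖joukowski w + 1‖ = ‖w‖ + ‖w‖⁻¹ := by
  have h1 : joukowski w - 1 = (w - 1) ^ 2 / (2 * w) := by rw [joukowski]; field_simp; ring
  have h2 : joukowski w + 1 = (w + 1) ^ 2 / (2 * w) := by rw [joukowski]; field_simp; ring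
  have hw' : ‖w‖ ≠ 0 := norm_ne_zero_iff.2 hw
  have h3 := parallelogram_law_with_norm ℝ w 1
  rw [norm_one] at h3
  rw [h1, h2, norm_div, norm_div, norm_pow, norm_pow, norm_mul, Complex.norm_ofNat]
  field_simp
  nlinarith

lemma joukowski_mem {ϱ : ℝ} (hϱ : 1 < ϱ) {w : ℂ} (h1 : ϱ⁻¹ < ‖w‖) (h2 : ‖w‖ < ϱ) :
    joukowski w ∈ bernsteinEllipse ϱ := by
  have h0 : 0 < ‖w‖ := lt_trans (by positivity) h1
  show ‖joukowski w - 1‖ + ‖joukowski w + 1‖ < ϱ + ϱ⁻¹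
  rw [norm_sub_one_add_norm_add_one_joukowski (norm_pos_iff.1 h0)]
  have h3 : 1 < ‖w‖ * ϱ := by rwa [inv_lt_iff_one_lt_mul₀ (by linarith)] at h1
  have : ϱ + ϱ⁻¹ - (‖w‖ + ‖w‖⁻¹) = (ϱ - ‖w‖) * (‖w‖ * ϱ - 1) / (‖w‖ * ϱ) := by
    field_simp; ring
  have : 0 < (ϱ - ‖w‖) * (‖w‖ * ϱ - 1) / (‖w‖ * ϱ) :=
    div_pos (mul_pos (by linarith) (by linarith)) (by linarith)
  linarith

lemma ofReal_mem_bernsteinEllipse {ϱ : ℝ} (hϱ : 1 < ϱ) {t : ℝ} (ht : t ∈ Set.Icc (-1 : ℝ) 1) :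
    (t : ℂ) ∈ bernsteinEllipse ϱ := by
  rw [← Real.cos_arccos ht.1 ht.2, ← joukowski_exp]
  apply joukowski_mem hϱ <;> rw [norm_exp_ofReal_mul_I]
  · exact inv_lt_one_of_one_lt₀ hϱ
  · exact hϱ

/-- The integral over `|w| = r` that defines the `n`-th Laurent coefficient of `F ∘ joukowski`. -/
def laurentCoeff (F : ℂ → ℂ) (n : ℤ) (r : ℝ) : ℂ :=
  (1 / (2 * Real.pi) : ℝ) •
    ∫ θ in (0 : ℝ)..2 * Real.pi, circleMap 0 r θ ^ (-n) * F (joukowski (circleMap 0 r θ))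

section OneVariable

variable {ϱ V : ℝ} {F : ℂ → ℂ}

/-- The Laurent coefficients do not depend on the radius. -/
lemma laurentCoeff_eq_of_le (hϱ : 1 < ϱ) (hF : DifferentiableOn ℂ F (bernsteinEllipse ϱ)) (n : ℤ)
    {r R : ℝ} (hr : ϱ⁻¹ < r) (hrR : r ≤ R) (hR : R < ϱ) :
    laurentCoeff F n R = laurentCoeff F n r := by
  have h0 : 0 < r := lt_trans (by positivity) hr
  set g : ℂ → ℂ := fun w => w ^ (-n) * F (joukowski w)
  have hd (z : ℂ) (h1 : ϱ⁻¹ < ‖z‖) (h2 : ‖z‖ < ϱ) : DifferentiableAt ℂ g z := by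
    have hz : z ≠ 0 := norm_pos_iff.1 (lt_trans (by positivity) h1)
    have hFz : DifferentiableAt ℂ F (joukowski z) :=
      hF.differentiableAt ((isOpen_bernsteinEllipse ϱ).mem_nhds (joukowski_mem hϱ h1 h2))
    have hJ : DifferentiableAt ℂ joukowski z :=
      ((differentiableAt_id.add (differentiableAt_inv hz)).div_const 2)
    exact (differentiableAt_zpow.2 (Or.inl hz)).mul (hFz.comp z hJ)
  have key := circleIntegral_sub_center_inv_smul_eq_of_differentiable_on_annulus_off_countable
    (c := 0) (f := g) h0 hrR Set.countable_empty
    (fun z hz => (hd z (by simp at hz; linarith) (by simp at hz; linarith)).continuousAt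
      |>.continuousWithinAt)
    (fun z hz => hd z (by simp at hz; linarith) (by simp at hz; linarith))
  have conv {s : ℝ} (hs : 0 < s) : (∮ z in C(0, s), (z - 0)⁻¹ • g z) =
      I * ∫ θ in (0 : ℝ)..2 * Real.pi, g (circleMap 0 s θ) := by
    rw [circleIntegral, ← intervalIntegral.integral_const_mul]
    refine intervalIntegral.integral_congr fun θ _ => ?_
    have : circleMap 0 s θ ≠ 0 := circleMap_ne_center hs.ne'
    simp only [deriv_circleMap, sub_zero, smul_eq_mul]
    field_simp
  rw [conv h0, conv (h0.trans_le hrR)] at key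
  rw [laurentCoeff, laurentCoeff, mul_left_cancel₀ I_ne_zero key]

lemma norm_laurentCoeff_le (hϱ : 1 < ϱ) (hV : ∀ z ∈ bernsteinEllipse ϱ, ‖F z‖ ≤ V) (n : ℤ)
    {r : ℝ} (h1 : ϱ⁻¹ < r) (h2 : r < ϱ) : ‖laurentCoeff F n r‖ ≤ V * r ^ (-n) := by
  have h0 : 0 < r := lt_trans (by positivity) h1
  have : ‖∫ θ in (0 : ℝ)..2 * Real.pi,
      circleMap 0 r θ ^ (-n) * F (joukowski (circleMap 0 r θ))‖ ≤
      r ^ (-n) * V * |2 * Real.pi - 0| := by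
    refine intervalIntegral.norm_integral_le_of_norm_le_const fun θ _ => ?_
    have hr : ‖circleMap 0 r θ‖ = r := by simp [abs_of_pos h0]
    rw [norm_mul, norm_zpow, hr]
    exact mul_le_mul_of_nonneg_left (hV _ (joukowski_mem hϱ (by rwa [hr]) (by rwa [hr])))
      (by positivity)
  rw [laurentCoeff, norm_smul, Real.norm_of_nonneg (by positivity)]
  rw [sub_zero, abs_of_pos Real.two_pi_pos] at this
  calc _ ≤ 1 / (2 * Real.pi) * (r ^ (-n) * V * (2 * Real.pi)) := by gcongr
    _ = _ := by field_simp

/-- Cauchy's estimate: let the radius tend to `ϱ` for `n ≥ 0` and to `ϱ⁻¹` for `n ≤ 0`. -/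
lemma norm_laurentCoeff_one_le (hϱ : 1 < ϱ) (hF : DifferentiableOn ℂ F (bernsteinEllipse ϱ))
    (hV : ∀ z ∈ bernsteinEllipse ϱ, ‖F z‖ ≤ V) (n : ℤ) :
    ‖laurentCoeff F n 1‖ ≤ V * ϱ⁻¹ ^ n.natAbs := by
  have hi : ϱ⁻¹ < 1 := inv_lt_one_of_one_lt₀ hϱ
  have hcont (s : ℝ) (hs : 0 < s) : Filter.Tendsto (fun r : ℝ => V * r ^ (-n)) (nhds s)
      (nhds (V * s ^ (-n))) :=
    ((continuousAt_zpow₀ s (-n) (Or.inl hs.ne')).tendsto).const_mul V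
  obtain ⟨m, rfl | rfl⟩ := n.eq_nat_or_neg
  · have h := (hcont ϱ (by linarith)).mono_left (nhdsWithin_le_nhds (s := Set.Iio ϱ))
    have : ‖laurentCoeff F m 1‖ ≤ V * ϱ ^ (-(m : ℤ)) := by
      refine ge_of_tendsto h ?_
      filter_upwards [Ioo_mem_nhdsLT hϱ] with r hr
      rw [← laurentCoeff_eq_of_le hϱ hF m hi hr.1.le hr.2]
      exact norm_laurentCoeff_le hϱ hV m (hi.trans hr.1) hr.2
    simpa using this
  · have h := (hcont ϱ⁻¹ (by positivity)).mono_left (nhdsWithin_le_nhds (s := Set.Ioi ϱ⁻¹))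
    have : ‖laurentCoeff F (-m) 1‖ ≤ V * ϱ⁻¹ ^ (-(-(m : ℤ))) := by
      refine ge_of_tendsto h ?_
      filter_upwards [Ioo_mem_nhdsGT hi] with r hr
      rw [laurentCoeff_eq_of_le hϱ hF _ hr.1 hr.2.le hϱ]
      exact norm_laurentCoeff_le hϱ hV _ hr.1 (hr.2.trans hϱ)
    simpa using this

lemma nonneg_of_norm_le_on_ellipse (hϱ : 1 < ϱ) (hV : ∀ z ∈ bernsteinEllipse ϱ, ‖F z‖ ≤ V) :
    0 ≤ V :=
  (norm_nonneg _).trans (hV _ (ofReal_mem_bernsteinEllipse hϱ (t := 0) (by simp)))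

/-- The Fourier series of `θ ↦ F (cos θ)`. -/
lemma hasSum_laurentCoeff (hϱ : 1 < ϱ) (hF : DifferentiableOn ℂ F (bernsteinEllipse ϱ))
    (hV : ∀ z ∈ bernsteinEllipse ϱ, ‖F z‖ ≤ V) (θ : ℝ) :
    HasSum (fun n : ℤ => laurentCoeff F n 1 * exp (n * θ * I)) (F (Real.cos θ)) := by
  have : Fact (0 < 2 * Real.pi) := ⟨Real.two_pi_pos⟩
  have hper : Function.Periodic (fun θ : ℝ => F (Real.cos θ)) (2 * Real.pi) := fun θ => by
    simp only [Real.cos_add_two_pi]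
  have hcont : Continuous fun θ : ℝ => F (Real.cos θ) :=
    hF.continuousOn.comp_continuous (by fun_prop)
      fun θ => ofReal_mem_bernsteinEllipse hϱ (Real.cos_mem_Icc θ)
  let f : C(AddCircle (2 * Real.pi), ℂ) := ⟨hper.lift, continuous_coinduced_dom.2 hcont⟩
  have hcoeff (n : ℤ) : fourierCoeff f n = laurentCoeff F n 1 := by
    rw [fourierCoeff_eq_intervalIntegral f n 0, laurentCoeff, zero_add]
    congr 1
    refine intervalIntegral.integral_congr fun θ _ => ?_
    have : circleMap 0 1 θ = exp (θ * I) := by simp [circleMap]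
    rw [this, joukowski_exp, smul_eq_mul, fourier_coe_apply, ← Complex.exp_int_mul]
    congr 2
    push_cast
    field_simp
  have hsum : Summable (fourierCoeff f) := by
    have hg : Summable fun n : ℤ => V * ϱ⁻¹ ^ n.natAbs := by
      refine Summable.mul_left V ?_
      have := summable_geometric_of_lt_one (r := ϱ⁻¹) (by positivity) (inv_lt_one_of_one_lt₀ hϱ)
      exact Summable.of_nat_of_neg (by simpa using this) (by simpa using this)
    refine Summable.of_norm_bounded hg fun n => ?_
    rw [hcoeff]
    exact norm_laurentCoeff_one_le hϱ hF hV n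
  have := has_pointwise_sum_fourier_series_of_summable hsum (θ : AddCircle (2 * Real.pi))
  convert! this using 2 with n
  rw [hcoeff, smul_eq_mul, fourier_coe_apply]
  congr 2
  push_cast
  field_simp

/-- The Chebyshev expansion of a bounded analytic function on a Bernstein ellipse. -/
lemma exists_hasSum_cos (hϱ : 1 < ϱ) (hF : DifferentiableOn ℂ F (bernsteinEllipse ϱ))
    (hV : ∀ z ∈ bernsteinEllipse ϱ, ‖F z‖ ≤ V) :
    ∃ a : ℕ → ℂ, (∀ n, ‖a n‖ ≤ 2 * V * ϱ⁻¹ ^ n) ∧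
      ∀ θ : ℝ, HasSum (fun n => a n * (Real.cos (n * θ) : ℂ)) (F (Real.cos θ)) := by
  set c : ℤ → ℂ := fun n => laurentCoeff F n 1
  have hc (n : ℤ) : ‖c n‖ ≤ V * ϱ⁻¹ ^ n.natAbs := norm_laurentCoeff_one_le hϱ hF hV n
  have hV0 := nonneg_of_norm_le_on_ellipse hϱ hV
  refine ⟨fun n => c n + c (-n) - if n = 0 then c 0 else 0, fun n => ?_, fun θ => ?_⟩
  · obtain rfl | hn := eq_or_ne n 0
    · have := hc 0
      simp at this ⊢
      linarith
    · simp only [hn, if_false, sub_zero]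
      have h1 := hc n
      have h2 := hc (-n)
      simp only [Int.natAbs_neg, Int.natAbs_natCast] at h1 h2
      linarith [norm_add_le (c n) (c (-n))]
  · -- Averaging the series at `θ` and `-θ` turns the exponentials into cosines.
    have h1 := hasSum_laurentCoeff hϱ hF hV θ
    have h2 := hasSum_laurentCoeff hϱ hF hV (-θ)
    rw [Real.cos_neg] at h2
    have h3 : HasSum (fun n : ℤ => c n * (Real.cos (n * θ) : ℂ)) (F (Real.cos θ)) := by
      have h12 := (h1.add h2).div_const 2
      rw [add_self_div_two] at h12
      convert! h12 using 2 with n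
      rw [ofReal_cos, Complex.cos]
      push_cast
      simp only [c, mul_neg, neg_mul]
      ring
    have h4 := h3.nat_add_neg.sub (hasSum_ite_eq 0 (c 0))
    simp only [Int.cast_zero, zero_mul, Real.cos_zero, ofReal_one, mul_one, add_sub_cancel_right]
      at h4
    convert! h4 using 2 with n
    obtain rfl | hn := eq_or_ne n 0
    · simp
    · simp [hn]
      ring

/-! ### One-dimensional error and stability bounds -/

/-- The Chebyshev interpolant of degree `N` of `F` on `[-1,1]`, evaluated at `t`. -/
def interpOne (N : ℕ) (F : ℂ → ℂ) (t : ℝ) : ℂ :=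
  ∑ k ∈ Finset.range (N + 1), (cardinal N k t : ℂ) * F (node N k)

/-- The value at `t` of the interpolant of `T_n`. -/
def aliased (N n : ℕ) (t : ℝ) : ℝ :=
  ∑ k ∈ Finset.range (N + 1), cardinal N k t * Real.cos (n * (Real.pi * ((k : ℝ) / N)))

lemma hasSum_interpOne {a : ℕ → ℂ}
    (ha : ∀ θ : ℝ, HasSum (fun n => a n * (Real.cos (n * θ) : ℂ)) (F (Real.cos θ)))
    (N : ℕ) (t : ℝ) : HasSum (fun n => a n * (aliased N n t : ℂ)) (interpOne N F t) := by
  have := hasSum_sum (s := Finset.range (N + 1)) fun k _ =>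
    (ha (Real.pi * ((k : ℝ) / N))).mul_left (cardinal N k t : ℂ)
  convert! this using 2 with n
  rw [aliased, ofReal_sum, Finset.mul_sum]
  refine Finset.sum_congr rfl fun k _ => ?_
  push_cast
  ring

/-- The interpolant of `F` is bounded by the sum of the moduli of the Chebyshev coefficients of
`F`; unlike the Lebesgue constant, this does not grow with the degree. -/
lemma norm_interpOne_le (hϱ : 1 < ϱ) (hF : DifferentiableOn ℂ F (bernsteinEllipse ϱ))
    (hV : ∀ z ∈ bernsteinEllipse ϱ, ‖F z‖ ≤ V) (N : ℕ) {t : ℝ} (ht : |t| ≤ 1) :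
    ‖interpOne N F t‖ ≤ V * (2 / (1 - 1 / ϱ)) := by
  obtain ⟨a, ha, hs⟩ := exists_hasSum_cos hϱ hF hV
  have hg := (hasSum_geometric_of_lt_one (r := ϱ⁻¹) (by positivity)
    (inv_lt_one_of_one_lt₀ hϱ)).mul_left (2 * V)
  refine ((hasSum_interpOne hs N t).norm_le_of_bounded hg fun n => ?_).trans_eq ?_
  · rw [norm_mul, norm_real, Real.norm_eq_abs]
    exact (mul_le_of_le_one_right (norm_nonneg _) (abs_sum_cardinal_mul_cos_le N n ht)).trans (ha n)
  · rw [one_div]; ring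

lemma norm_sub_interpOne_le (hϱ : 1 < ϱ) (hF : DifferentiableOn ℂ F (bernsteinEllipse ϱ))
    (hV : ∀ z ∈ bernsteinEllipse ϱ, ‖F z‖ ≤ V) (N : ℕ) {t : ℝ} (ht : |t| ≤ 1) :
    ‖F t - interpOne N F t‖ ≤ V * (4 * (ϱ ^ (-(N : ℤ)) / (ϱ - 1))) := by
  obtain ⟨a, ha, hs⟩ := exists_hasSum_cos hϱ hF hV
  have hθ := Real.cos_arccos (abs_le.1 ht).1 (abs_le.1 ht).2
  have h1 := hs (Real.arccos t)
  rw [hθ] at h1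
  have hT (n : ℕ) : Real.cos (n * Real.arccos t) = (T ℝ (n : ℤ)).eval t := by
    conv_rhs => rw [← hθ, T_real_cos]
    rfl
  have h2 := h1.sub (hasSum_interpOne hs N t)
  -- The terms with `n ≤ N` vanish because `T_n` is reproduced by the interpolation.
  rw [← hasSum_nat_add_iff' (N + 1), Finset.sum_eq_zero, sub_zero] at h2
  · have hg := (hasSum_geometric_of_lt_one (r := ϱ⁻¹) (by positivity)
      (inv_lt_one_of_one_lt₀ hϱ)).mul_left (4 * V * ϱ⁻¹ ^ (N + 1))
    refine (h2.norm_le_of_bounded hg fun n => ?_).trans_eq ?_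
    · rw [← mul_sub, norm_mul, ← ofReal_sub, norm_real, Real.norm_eq_abs]
      have h3 : |Real.cos ((n + (N + 1) : ℕ) * Real.arccos t) - aliased N (n + (N + 1)) t| ≤ 2 := by
        have := abs_sub (Real.cos ((n + (N + 1) : ℕ) * Real.arccos t)) (aliased N (n + (N + 1)) t)
        have h4 := Real.abs_cos_le_one ((n + (N + 1) : ℕ) * Real.arccos t)
        have h5 : |aliased N (n + (N + 1)) t| ≤ 1 := abs_sum_cardinal_mul_cos_le N _ ht
        linarith
      calc _ ≤ (2 * V * ϱ⁻¹ ^ (n + (N + 1))) * 2 :=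
            mul_le_mul (ha _) h3 (abs_nonneg _) ((norm_nonneg _).trans (ha _))
        _ = _ := by ring
    · rw [zpow_neg, zpow_natCast]
      have : ϱ - 1 ≠ 0 := by linarith
      have h0 : ϱ ≠ 0 := by linarith
      have h1 : 1 - ϱ⁻¹ ≠ 0 := by
        have := inv_lt_one_of_one_lt₀ hϱ
        linarith
      rw [inv_pow, pow_succ]
      field_simp
  · intro n hn
    rw [aliased, sum_cardinal_mul_cos (Nat.lt_succ_iff.1 (Finset.mem_range.1 hn)), hT, sub_self]

end OneVariable

/-! ### Tensor products of interpolation operators -/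

/-- `G` is analytic in each variable separately, and bounded by `M`, on the product of the Bernstein
ellipses of `[-1,1]` with parameters `ϱ i`. -/
structure SepAnalyticBound {D : ℕ} (ϱ : Fin D → ℝ) (M : ℝ) (G : (Fin D → ℂ) → ℂ) : Prop where
  differentiableOn : ∀ z : Fin D → ℂ, (∀ i, z i ∈ bernsteinEllipse (ϱ i)) → ∀ i,
    DifferentiableOn ℂ (fun w => G (Function.update z i w)) (bernsteinEllipse (ϱ i))
  norm_le : ∀ z : Fin D → ℂ, (∀ i, z i ∈ bernsteinEllipse (ϱ i)) → ‖G z‖ ≤ M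

/-- The tensorized Chebyshev interpolant of `G`, evaluated at `t`, in terms of nodal values. -/
def interpTensor {D : ℕ} (N : Fin D → ℕ) (G : (Fin D → ℂ) → ℂ) (t : Fin D → ℝ) : ℂ :=
  ∑ k ∈ multiIndices N, ((∏ i, cardinal (N i) (k i) (t i) : ℝ) : ℂ) *
    G fun i => (node (N i) (k i) : ℂ)

lemma sum_multiIndices_succ {E : Type*} [AddCommMonoid E] {D : ℕ} (N : Fin (D + 1) → ℕ)
    (h : (Fin (D + 1) → ℕ) → E) :
    ∑ k ∈ multiIndices N, h k =
      ∑ k ∈ multiIndices fun i : Fin D => N i.castSucc, ∑ l ∈ Finset.range (N (Fin.last D) + 1),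
        h (Fin.snoc (α := fun _ => ℕ) k l) := by
  rw [← Finset.sum_product']
  symm
  refine Finset.sum_nbij' (fun p => Fin.snoc (α := fun _ => ℕ) p.1 p.2)
    (fun k => (fun i => k i.castSucc, k (Fin.last D))) ?_ ?_ ?_ ?_ ?_
  · rintro ⟨k, l⟩ h
    simp only [multiIndices, Finset.mem_product, Fintype.mem_piFinset] at h ⊢
    intro i
    induction i using Fin.lastCases with
    | last => simpa using h.2
    | cast i => simpa using h.1 i
  · intro k h
    simp only [multiIndices, Finset.mem_product, Fintype.mem_piFinset] at h ⊢
    exact ⟨fun i => h _, h _⟩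
  · rintro ⟨k, l⟩ _
    simp
  · intro k _
    exact Fin.snoc_init_self k
  · intros; rfl

lemma interpTensor_succ {D : ℕ} (N : Fin (D + 1) → ℕ) (G : (Fin (D + 1) → ℂ) → ℂ)
    (t : Fin (D + 1) → ℝ) :
    interpTensor N G t = interpTensor (fun i : Fin D => N i.castSucc)
      (fun z => interpOne (N (Fin.last D)) (fun w => G (Fin.snoc (α := fun _ => ℂ) z w))
        (t (Fin.last D))) (fun i => t i.castSucc) := by
  rw [interpTensor, interpTensor, sum_multiIndices_succ]
  refine Finset.sum_congr rfl fun k _ => ?_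
  rw [interpOne, Finset.mul_sum]
  refine Finset.sum_congr rfl fun l _ => ?_
  rw [Fin.prod_univ_castSucc]
  simp only [Fin.snoc_castSucc, Fin.snoc_last]
  push_cast
  rw [mul_assoc]
  congr 3
  ext i
  induction i using Fin.lastCases <;> simp

lemma interpTensor_zero (N : Fin 0 → ℕ) (G : (Fin 0 → ℂ) → ℂ) (t : Fin 0 → ℝ) :
    interpTensor N G t = G fun i => (t i : ℂ) := by
  have : multiIndices N = {default} := by
    ext k
    simp only [multiIndices, Fintype.mem_piFinset, Finset.mem_singleton]
    exact ⟨fun _ => Subsingleton.elim _ _, fun _ i => i.elim0⟩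
  rw [interpTensor, this, Finset.sum_singleton, Finset.univ_eq_empty, Finset.prod_empty, ofReal_one,
    one_mul]
  exact congrArg G (Subsingleton.elim _ _)

lemma interpTensor_sub {D : ℕ} (N : Fin D → ℕ) (G H : (Fin D → ℂ) → ℂ) (t : Fin D → ℝ) :
    interpTensor N (fun z => G z - H z) t = interpTensor N G t - interpTensor N H t := by
  simp only [interpTensor, mul_sub, Finset.sum_sub_distrib]

lemma node_mem_Icc (N k : ℕ) : node N k ∈ Set.Icc (-1 : ℝ) 1 := Real.cos_mem_Icc _

section LastVariable

variable {D : ℕ} {ϱ : Fin (D + 1) → ℝ} {M : ℝ} {G : (Fin (D + 1) → ℂ) → ℂ}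

lemma snoc_mem_ellipse {z : Fin D → ℂ} (hz : ∀ i, z i ∈ bernsteinEllipse (ϱ i.castSucc))
    {w : ℂ} (hw : w ∈ bernsteinEllipse (ϱ (Fin.last D))) (i : Fin (D + 1)) :
    Fin.snoc (α := fun _ => ℂ) z w i ∈ bernsteinEllipse (ϱ i) := by
  induction i using Fin.lastCases with
  | last => simpa using hw
  | cast i => simpa using hz i

lemma SepAnalyticBound.snoc (h : SepAnalyticBound ϱ M G) {w : ℂ}
    (hw : w ∈ bernsteinEllipse (ϱ (Fin.last D))) :
    SepAnalyticBound (fun i : Fin D => ϱ i.castSucc) M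
      (fun z => G (Fin.snoc (α := fun _ => ℂ) z w)) where
  differentiableOn z hz i := by
    simpa only [Fin.snoc_update] using h.differentiableOn _ (snoc_mem_ellipse hz hw) i.castSucc
  norm_le z hz := h.norm_le _ (snoc_mem_ellipse hz hw)

lemma SepAnalyticBound.differentiableOn_snoc (h : SepAnalyticBound ϱ M G)
    (hϱ : 1 < ϱ (Fin.last D)) {z : Fin D → ℂ}
    (hz : ∀ i, z i ∈ bernsteinEllipse (ϱ i.castSucc)) :
    DifferentiableOn ℂ (fun w => G (Fin.snoc (α := fun _ => ℂ) z w))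
      (bernsteinEllipse (ϱ (Fin.last D))) := by
  have h0 := ofReal_mem_bernsteinEllipse hϱ (t := 0) (by simp)
  simpa only [Fin.update_snoc_last] using
    h.differentiableOn _ (snoc_mem_ellipse hz h0) (Fin.last D)

lemma SepAnalyticBound.interpOne_last (h : SepAnalyticBound ϱ M G) (hϱ : 1 < ϱ (Fin.last D))
    (N : ℕ) {t : ℝ} (ht : |t| ≤ 1) :
    SepAnalyticBound (fun i : Fin D => ϱ i.castSucc) (M * (2 / (1 - 1 / ϱ (Fin.last D))))
      (fun z => interpOne N (fun w => G (Fin.snoc (α := fun _ => ℂ) z w)) t) where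
  differentiableOn z hz i := by
    simp only [interpOne]
    exact DifferentiableOn.fun_sum fun k _ => ((h.snoc (ofReal_mem_bernsteinEllipse hϱ
      (node_mem_Icc N k))).differentiableOn z hz i).const_mul _
  norm_le z hz := norm_interpOne_le hϱ (h.differentiableOn_snoc hϱ hz)
    (fun _ hw => h.norm_le _ (snoc_mem_ellipse hz hw)) N ht

lemma SepAnalyticBound.sub_interpOne_last (h : SepAnalyticBound ϱ M G)
    (hϱ : 1 < ϱ (Fin.last D)) (N : ℕ) {t : ℝ} (ht : |t| ≤ 1) :
    SepAnalyticBound (fun i : Fin D => ϱ i.castSucc)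
      (M * (4 * (ϱ (Fin.last D) ^ (-(N : ℤ)) / (ϱ (Fin.last D) - 1))))
      (fun z => G (Fin.snoc (α := fun _ => ℂ) z t) -
        interpOne N (fun w => G (Fin.snoc (α := fun _ => ℂ) z w)) t) where
  differentiableOn _ hz i :=
    ((h.snoc (ofReal_mem_bernsteinEllipse hϱ (abs_le.1 ht))).differentiableOn _ hz i).sub
      ((h.interpOne_last hϱ N ht).differentiableOn _ hz i)
  norm_le _ hz := norm_sub_interpOne_le hϱ (h.differentiableOn_snoc hϱ hz)
    (fun _ hw => h.norm_le _ (snoc_mem_ellipse hz hw)) N ht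

end LastVariable

lemma norm_interpTensor_le {D : ℕ} {ϱ : Fin D → ℝ} (hϱ : ∀ i, 1 < ϱ i) (N : Fin D → ℕ) {M : ℝ}
    {G : (Fin D → ℂ) → ℂ} (h : SepAnalyticBound ϱ M G) {t : Fin D → ℝ} (ht : ∀ i, |t i| ≤ 1) :
    ‖interpTensor N G t‖ ≤ M * ∏ i, (2 / (1 - 1 / ϱ i)) := by
  induction D generalizing M with
  | zero =>
    rw [interpTensor_zero]
    simpa using h.norm_le (fun i => (t i : ℂ)) fun i => i.elim0
  | succ D ih =>
    rw [interpTensor_succ, Fin.prod_univ_castSucc, mul_comm (∏ _, _), ← mul_assoc]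
    exact ih (fun i => hϱ _) _ (h.interpOne_last (hϱ _) _ (ht _)) fun i => ht _

/-- Interpolating the variables one after another: in the telescoping sum, the one-dimensional error
in the variable `k` is interpolated in the variables `j < k`. -/
lemma norm_sub_interpTensor_le {D : ℕ} {ϱ : Fin D → ℝ} (hϱ : ∀ i, 1 < ϱ i) (N : Fin D → ℕ) {M : ℝ}
    {G : (Fin D → ℂ) → ℂ} (h : SepAnalyticBound ϱ M G) {t : Fin D → ℝ} (ht : ∀ i, |t i| ≤ 1) :
    ‖G (fun i => (t i : ℂ)) - interpTensor N G t‖ ≤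
      ∑ k, M * (4 * (ϱ k ^ (-(N k : ℤ)) / (ϱ k - 1))) *
        ∏ j with j < k, (2 / (1 - 1 / ϱ j)) := by
  induction D generalizing M with
  | zero =>
    simp [interpTensor_zero]
  | succ D ih =>
    have htl := ofReal_mem_bernsteinEllipse (hϱ (Fin.last D)) (abs_le.1 (ht (Fin.last D)))
    have h1 := ih (fun i => hϱ i.castSucc) (fun i => N i.castSucc) (h.snoc htl)
      (t := fun i => t i.castSucc) fun i => ht _
    have h2 := norm_interpTensor_le (fun i => hϱ i.castSucc) (fun i => N i.castSucc)
      (h.sub_interpOne_last (hϱ _) (N (Fin.last D)) (ht (Fin.last D))) (t := fun i => t i.castSucc)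
      fun i => ht _
    rw [interpTensor_sub, ← interpTensor_succ] at h2
    have h3 : Fin.snoc (α := fun _ => ℂ) (fun i : Fin D => (t i.castSucc : ℂ))
        (t (Fin.last D) : ℂ) = fun i => (t i : ℂ) :=
      Fin.snoc_init_self (fun i => (t i : ℂ))
    rw [h3] at h1
    have h4 := norm_add_le _ _ |>.trans (add_le_add h1 h2)
    rw [sub_add_sub_cancel] at h4
    refine h4.trans_eq ?_
    rw [Fin.sum_univ_castSucc]
    congr 1
    · refine Finset.sum_congr rfl fun k _ => ?_
      congr 1
      rw [Finset.prod_filter, Finset.prod_filter, Fin.prod_univ_castSucc]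
      simp [Fin.le_last]
    · congr 1
      rw [Finset.prod_filter, Fin.prod_univ_castSucc]
      simp [Fin.castSucc_lt_last]

lemma interpTensor_perm {D : ℕ} (σ : Equiv.Perm (Fin D)) (N : Fin D → ℕ) (G : (Fin D → ℂ) → ℂ)
    (t : Fin D → ℝ) :
    interpTensor (fun i => N (σ i)) (fun z => G fun i => z (σ.symm i)) (fun i => t (σ i)) =
      interpTensor N G t := by
  rw [interpTensor, interpTensor]
  refine Finset.sum_equiv (Equiv.arrowCongr σ (Equiv.refl ℕ)) (fun k => ?_) fun k _ => ?_
  · simp only [multiIndices, Fintype.mem_piFinset]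
    exact ⟨fun h i => by simpa using h (σ.symm i), fun h i => by simpa using h (σ i)⟩
  · simp only [Equiv.arrowCongr_apply, Function.comp_apply, Equiv.refl_apply,
      Equiv.apply_symm_apply]
    congr 2
    exact Fintype.prod_equiv σ _ _ fun i => by simp

lemma SepAnalyticBound.perm {D : ℕ} {ϱ : Fin D → ℝ} {M : ℝ} {G : (Fin D → ℂ) → ℂ}
    (h : SepAnalyticBound ϱ M G) (σ : Equiv.Perm (Fin D)) :
    SepAnalyticBound (fun i => ϱ (σ i)) M (fun z => G fun i => z (σ.symm i)) where
  differentiableOn z hz i := by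
    convert! h.differentiableOn (fun i => z (σ.symm i))
      (fun i => by simpa using hz (σ.symm i)) (σ i) using 3 with w
    ext j
    simp only [Function.update_apply, Equiv.symm_apply_eq]
  norm_le z hz := h.norm_le _ fun i => by simpa using hz (σ.symm i)

/-- The coefficient form of the tensorized interpolation agrees with its nodal form. -/
lemma ofReal_interpStd {D : ℕ} (N : Fin D → ℕ) (g : (Fin D → ℝ) → ℝ) (G : (Fin D → ℂ) → ℂ)
    (hG : ∀ t : Fin D → ℝ, (∀ i, t i ∈ Set.Icc (-1 : ℝ) 1) → G (fun i => (t i : ℂ)) = g t)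
    (t : Fin D → ℝ) : (interpStd N g t : ℂ) = interpTensor N G t := by
  have h : interpStd N g t = ∑ k ∈ multiIndices N, (∏ i, cardinal (N i) (k i) (t i)) *
      g fun i => node (N i) (k i) := by
    simp only [interpStd, coeff, cardinal, Finset.prod_univ_sum, Finset.mul_sum, Finset.sum_mul]
    rw [Finset.sum_comm]
    refine Finset.sum_congr rfl fun k _ => Finset.sum_congr rfl fun j _ => ?_
    simp only [Finset.prod_mul_distrib, mul_assoc]
    ring
  rw [h, interpTensor, ofReal_sum]
  refine Finset.sum_congr rfl fun k _ => ?_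
  rw [ofReal_mul, hG _ fun i => node_mem_Icc _ _]

/-! ### Transport to the hyperrectangle and comparison with the error bound -/

lemma transformC_eq (a b : ℝ) (z : ℂ) : transformC a b z = b + (a - b) / 2 * (1 - z) := by
  apply Complex.ext
  · simp [transformC]
  · simp [transformC]
    ring

lemma transformC_ofReal (a b t : ℝ) : transformC a b t = (transform a b t : ℂ) := by
  rw [transformC_eq, transform]
  push_cast
  rfl

lemma differentiable_transformC (a b : ℝ) : Differentiable ℂ (transformC a b) := by
  rw [funext (transformC_eq a b)]
  fun_prop

lemma transform_mem_Icc {a b t : ℝ} (hab : a < b) (ht : t ∈ Set.Icc (-1 : ℝ) 1) :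
    transform a b t ∈ Set.Icc a b := by
  obtain ⟨h1, h2⟩ := ht
  constructor <;> rw [transform] <;> nlinarith

lemma transform_transformInv {a b : ℝ} (hab : a < b) (x : ℝ) :
    transform a b (transformInv a b x) = x := by
  have : b - a ≠ 0 := by linarith
  rw [transform, transformInv]
  field_simp
  ring

lemma abs_transformInv_le {a b x : ℝ} (hab : a < b) (hx : x ∈ Set.Icc a b) :
    |transformInv a b x| ≤ 1 := by
  have h0 : 0 < b - a := by linarith
  obtain ⟨h1, h2⟩ := hx
  have h3 : 0 ≤ 2 * (b - x) / (b - a) := div_nonneg (by linarith) h0.le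
  have h4 : 2 * (b - x) / (b - a) ≤ 2 := by
    rw [div_le_iff₀ h0]
    linarith
  rw [abs_le, transformInv]
  constructor <;> linarith

lemma ofReal_mem_genBernsteinEllipse {D : ℕ} {a b ϱ : Fin D → ℝ} (hab : ∀ i, a i < b i)
    (hϱ : ∀ i, 1 < ϱ i) {x : Fin D → ℝ} (hx : x ∈ Set.Icc a b) :
    (fun i => (x i : ℂ)) ∈ genBernsteinEllipse a b ϱ := fun i _ =>
  ⟨(transformInv (a i) (b i) (x i) : ℂ), ofReal_mem_bernsteinEllipse (hϱ i)
    (abs_le.1 (abs_transformInv_le (hab i) ⟨hx.1 i, hx.2 i⟩)), by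
      rw [transformC_ofReal, transform_transformInv (hab i)]⟩

lemma SepAnalyticBound.comp_transformC {D : ℕ} {a b ϱ : Fin D → ℝ} {V : ℝ} {F : (Fin D → ℂ) → ℂ}
    (hF : AnalyticOnNhd ℂ F (genBernsteinEllipse a b ϱ))
    (hV : ∀ z ∈ genBernsteinEllipse a b ϱ, ‖F z‖ ≤ V) :
    SepAnalyticBound ϱ V (fun z => F fun i => transformC (a i) (b i) (z i)) where
  differentiableOn z hz i w hw := by
    have hmem : (fun j => transformC (a j) (b j) (Function.update z i w j)) ∈
        genBernsteinEllipse a b ϱ := by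
      intro j _
      refine Set.mem_image_of_mem _ ?_
      obtain rfl | hj := eq_or_ne j i
      · simpa using hw
      · simpa [hj] using hz j
    have hinner : DifferentiableAt ℂ
        (fun w => fun j => transformC (a j) (b j) (Function.update z i w j)) w := by
      refine differentiableAt_pi.2 fun j => ?_
      obtain rfl | hj := eq_or_ne j i
      · simpa using differentiable_transformC _ _ w
      · simp [hj]
    exact ((hF _ hmem).differentiableAt.comp w hinner).differentiableWithinAt
  norm_le z hz := hV _ fun i _ => Set.mem_image_of_mem _ (hz i)

lemma continuous_interp {D : ℕ} (a b : Fin D → ℝ) (N : Fin D → ℕ) (f : (Fin D → ℝ) → ℝ) :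
    Continuous (interp a b N f) := by
  unfold interp interpStd transformInv
  refine continuous_finsetSum _ fun j _ => continuous_const.mul
    (continuous_finsetProd _ fun i _ => (Polynomial.continuous _).comp ?_)
  fun_prop

/-- For `k ≥ 1` the telescoping bound contributes `2 ^ k / ∏ j < k, (1 - 1 / ϱ j)` times the
one-dimensional error, and the corresponding factor in `permBound` is larger, since
`k + 2 ^ k - 1 ≥ 1`. -/
lemma sum_le_permBound {D : ℕ} {ϱ : Fin D → ℝ} (hϱ : ∀ i, 1 < ϱ i) (N : Fin D → ℕ) {V : ℝ}
    (hV : 0 ≤ V) (σ : Equiv.Perm (Fin D)) :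
    ∑ k, V * (4 * (ϱ (σ k) ^ (-(N (σ k) : ℤ)) / (ϱ (σ k) - 1))) *
      ∏ j with j < k, (2 / (1 - 1 / ϱ (σ j))) ≤ permBound V ϱ N σ := by
  rw [permBound, Finset.sum_filter, ← Finset.sum_add_distrib]
  refine Finset.sum_le_sum fun k _ => ?_
  have hε : 0 ≤ 4 * V * (ϱ (σ k) ^ (-(N (σ k) : ℤ)) / (ϱ (σ k) - 1)) := by
    have h1 := hϱ (σ k)
    have h2 : 0 < ϱ (σ k) - 1 := by linarith
    have h3 : 0 < ϱ (σ k) := by linarith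
    positivity
  have hP : 0 < ∏ j with j < k, (1 - 1 / ϱ (σ j)) := Finset.prod_pos fun j _ => by
    have := inv_lt_one_of_one_lt₀ (hϱ (σ j))
    rw [one_div]
    linarith
  have hcard : (Finset.univ.filter fun j : Fin D => j < k).card = k := by
    rw [Finset.filter_gt_eq_Iio, Fin.card_Iio]
  rw [Finset.prod_div_distrib, Finset.prod_const, hcard, mul_left_comm, ← mul_assoc 4,
    ← mul_assoc]
  split_ifs with hk
  · have h1 : (1 : ℝ) ≤ (k : ℕ) := by exact_mod_cast hk
    have h2 : (1 : ℝ) ≤ 2 ^ (k : ℕ) := one_le_pow₀ one_le_two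
    have h3 : (2 : ℝ) ^ (k : ℕ) / ∏ j with j < k, (1 - 1 / ϱ (σ j)) ≤
        2 ^ (k : ℕ) * ((((k : ℕ) : ℝ) + 2 ^ (k : ℕ) - 1) / ∏ j with j < k, (1 - 1 / ϱ (σ j))) := by
      rw [← mul_div_assoc]
      gcongr
      exact le_mul_of_one_le_right (by positivity) (by linarith)
    have h4 := mul_le_mul_of_nonneg_left h3 hε
    linarith
  · have hk0 : (k : ℕ) = 0 := by omega
    have h5 : (Finset.univ.filter fun j : Fin D => j < k) = ∅ := by
      rw [← Finset.card_eq_zero, hcard, hk0]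
    simp [h5, hk0]

lemma abs_sub_interp_le_permBound {D : ℕ} {a b : Fin D → ℝ} (hab : ∀ i, a i < b i)
    (N : Fin D → ℕ) {ϱ : Fin D → ℝ} (hϱ : ∀ i, 1 < ϱ i) {V : ℝ}
    {f : (Fin D → ℝ) → ℝ} {F : (Fin D → ℂ) → ℂ}
    (hF : AnalyticOnNhd ℂ F (genBernsteinEllipse a b ϱ))
    (hFf : ∀ x ∈ Set.Icc a b, F (fun i => (x i : ℂ)) = (f x : ℂ))
    (hV : ∀ z ∈ genBernsteinEllipse a b ϱ, ‖F z‖ ≤ V) {x : Fin D → ℝ} (hx : x ∈ Set.Icc a b)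
    (σ : Equiv.Perm (Fin D)) : |f x - interp a b N f x| ≤ permBound V ϱ N σ := by
  set G : (Fin D → ℂ) → ℂ := fun z => F fun i => transformC (a i) (b i) (z i) with hG
  set t : Fin D → ℝ := fun i => transformInv (a i) (b i) (x i) with ht
  have hGs : SepAnalyticBound ϱ V G := SepAnalyticBound.comp_transformC hF hV
  have htl (i : Fin D) : |t i| ≤ 1 := abs_transformInv_le (hab i) ⟨hx.1 i, hx.2 i⟩
  have hV0 : 0 ≤ V := (norm_nonneg _).trans (hV _ (ofReal_mem_genBernsteinEllipse hab hϱ hx))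
  have hfx : (f x : ℂ) = G fun i => (t i : ℂ) := by
    simp only [hG, ht, transformC_ofReal, transform_transformInv (hab _), hFf x hx]
  have hint : (interp a b N f x : ℂ) = interpTensor N G t := by
    rw [interp]
    refine ofReal_interpStd N _ G (fun s hs => ?_) t
    simp only [hG, transformC_ofReal]
    exact hFf _ ⟨fun i => (transform_mem_Icc (hab i) (hs i)).1,
      fun i => (transform_mem_Icc (hab i) (hs i)).2⟩
  have key := norm_sub_interpTensor_le (fun i => hϱ (σ i)) (fun i => N (σ i)) (hGs.perm σ)
    (t := fun i => t (σ i)) fun i => htl _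
  rw [interpTensor_perm, ← hint] at key
  simp only [Equiv.apply_symm_apply] at key
  rw [← hfx, ← ofReal_sub, norm_real, Real.norm_eq_abs] at key
  exact key.trans (sum_le_permBound hϱ N hV0 σ)

end TensorChebyshev

end

theorem proposition1 {D : ℕ} (a b : Fin D → ℝ) (hab : ∀ i, a i < b i)
    (N : Fin D → ℕ) (ϱ : Fin D → ℝ) (hϱ : ∀ i, 1 < ϱ i) (V : ℝ)
    (f : (Fin D → ℝ) → ℝ) (F : (Fin D → ℂ) → ℂ)
    (hF : AnalyticOnNhd ℂ F (TensorChebyshev.genBernsteinEllipse a b ϱ))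
    (hFf : ∀ x ∈ Set.Icc a b, F (fun i => (x i : ℂ)) = (f x : ℂ))
    (hV : ∀ z ∈ TensorChebyshev.genBernsteinEllipse a b ϱ, ‖F z‖ ≤ V) :
    ∃ m : ℝ,
      IsGreatest ((fun x => |f x - TensorChebyshev.interp a b N f x|) '' Set.Icc a b) m ∧
        m ≤ TensorChebyshev.errorBound V ϱ N := by
  have hcast : ContinuousOn (fun x : Fin D → ℝ => F fun i => (x i : ℂ)) (Set.Icc a b) :=
    hF.continuousOn.comp (by fun_prop)
      fun x hx => TensorChebyshev.ofReal_mem_genBernsteinEllipse hab hϱ hx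
  have hf : ContinuousOn f (Set.Icc a b) :=
    (Complex.continuous_re.comp_continuousOn hcast).congr fun x hx => by
      simp [hFf x hx]
  have hcont : ContinuousOn (fun x => |f x - TensorChebyshev.interp a b N f x|) (Set.Icc a b) :=
    (hf.sub (TensorChebyshev.continuous_interp a b N f).continuousOn).abs
  obtain ⟨m, hm⟩ := (isCompact_Icc.image_of_continuousOn hcont).exists_isGreatest
    ((Set.nonempty_Icc.2 fun i => (hab i).le).image _)
  refine ⟨m, hm, ?_⟩
  obtain ⟨x, hx, rfl⟩ := hm.1
  exact Finset.le_inf' _ _ fun σ _ =>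
    TensorChebyshev.abs_sub_interp_le_permBound hab N hϱ hF hFf hV hx σ
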